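/- All graphs are finite and simple. Let $G$ be a graph with vertices $v_1,\dots,v_N$ and let $k\in\mathbb N=\{0,1,2,\dots\}$. For a family $\sigma=(\sigma_e)_{e\in E(G)}$ of permutations of $[k]=\{1,\dots,k\}$, let $H_\sigma$ be the graph with vertex set $V(G)\times[k]$ whose edges are the pairs $(v_q,i)(v_r,\sigma_e(i))$ with $e=v_qv_r\in E(G)$, $q<r$, and $i\in[k]$; together with the lists $L(v)=\{v\}\times[k]$ it is a full $k$-fold DP-cover of $G$. Say that $G$ is colorable from this cover if there is an independent set of $H_\sigma$ that contains exactly one vertex from each list $L(v)$, and let $p(G,k)$ be the probability that $G$ is colorable from the cover given by $\sigma$, when $\sigma$ is chosen uniformly at random among all $(k!)^{|E(G)|}$ families. A function $t\colon\mathbb N\to\mathbb R$ is a *sharp DP-threshold function* for a sequence of graphs $(G_n)_{n\in\mathbb N}$ if for every $\epsilon>0$ and every sequence $(k_n)_{n\in\mathbb N}$ of nonnegative integers: 1. if $k_n\le(1-\epsilon)\,t(n)$ for all sufficiently large $n$, then $\lim_{n\to\infty}p(G_n,k_n)=0$; 2. if $k_n\ge(1+\epsilon)\,t(n)$ for all sufficiently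 large $n$, then $\lim_{n\to\infty}p(G_n,k_n)=1$. **Corollary.** Let $m\ge2$ be a fixed integer, and for $n\in\mathbb N$ let $K_{m\times n}$ be the complete $m$-partite graph with $n$ vertices in each part. Then $$t(n)=\frac{(m-1)\,n}{2\ln n}$$ (with arbitrary values at $n=0,1$) is a sharp DP-threshold function for the sequence $(K_{m\times n})_{n\in\mathbb N}$. -/

import Mathlib

open Filter Topology

universe u v

/-- A DP-cover `(L, H)` of a graph `G`: the lists `L v` partition the vertex set `W` of `H` into
independent sets (indexed by the vertices of `G`), the edges of `H` between the lists of two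
adjacent vertices form a matching, and all edges of `H` lie between lists of adjacent vertices. -/
structure DPCover {V : Type u} (G : SimpleGraph V) (W : Type v) where
  /-- the cover graph -/
  H : SimpleGraph W
  /-- the list of each vertex -/
  L : V → Set W
  disjoint : ∀ a b : V, a ≠ b → Disjoint (L a) (L b)
  covers : ∀ x : W, ∃ a : V, x ∈ L a
  indep : ∀ a : V, H.IsIndepSet (L a)
  -- the roles of `a` and `b` can be swapped, so this says that no two edges share an endpoint
  matching : ∀ a b : V, G.Adj a b → ∀ x ∈ L a, ∀ y ∈ L b, ∀ z ∈ L b,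
    H.Adj x y → H.Adj x z → y = z
  edges : ∀ x y : W, H.Adj x y → ∃ a b : V, G.Adj a b ∧ x ∈ L a ∧ y ∈ L b

namespace DPCover

variable {V : Type u} {G : SimpleGraph V} {W : Type v}

/-- A transversal: a set of vertices of `H` with exactly one vertex in each list. -/
def IsTransversal (C : DPCover G W) (T : Set W) : Prop :=
  ∀ a : V, ∃! x : W, x ∈ C.L a ∧ x ∈ T

/-- `G` is `C`-colorable: the cover `C` has an independent transversal. -/
def Colorable (C : DPCover G W) : Prop :=
  ∃ T : Set W, C.IsTransversal T ∧ C.H.IsIndepSet T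

end DPCover

section RandomCover

variable {V : Type u} [LinearOrder V]

/-- The graph `H_σ` on `V × [k]`: for each edge `e = ab` of `G` with `a < b`, the vertex `(a, i)`
is joined to `(b, σ_e i)` for every `i`. -/
def permCoverGraph (G : SimpleGraph V) (k : ℕ) (σ : G.edgeSet → Equiv.Perm (Fin k)) :
    SimpleGraph (V × Fin k) where
  Adj x y := ∃ h : G.Adj x.1 y.1,
    (x.1 < y.1 ∧ σ ⟨s(x.1, y.1), h⟩ x.2 = y.2) ∨
    (y.1 < x.1 ∧ σ ⟨s(y.1, x.1), h.symm⟩ y.2 = x.2)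
  symm := ⟨fun _ _ ⟨h, h'⟩ => ⟨h.symm, h'.symm⟩⟩
  loopless := ⟨fun _ ⟨h, _⟩ => G.irrefl h⟩

/-- The full `k`-fold cover of `G` given by a family of permutations of `[k]` indexed by the edges
of `G`; the list of `a` is `{a} × [k]`. -/
def permCover (G : SimpleGraph V) (k : ℕ) (σ : G.edgeSet → Equiv.Perm (Fin k)) :
    DPCover G (V × Fin k) where
  H := permCoverGraph G k σ
  L a := {x | x.1 = a}
  disjoint a b hab := by
    rw [Set.disjoint_left]
    rintro x rfl h
    exact hab h
  covers x := ⟨x.1, rfl⟩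
  indep a := by
    rintro x hx y hy _ ⟨h, _⟩
    rw [Set.mem_ofPred_eq] at hx hy
    rw [hx, hy] at h
    exact G.irrefl h
  matching a b _ := by
    rintro ⟨a, i⟩ rfl ⟨b, j⟩ rfl ⟨c, l⟩ hc ⟨h, h1⟩ ⟨h', h2⟩
    simp only [Set.mem_ofPred_eq] at hc
    subst hc
    rcases h1 with ⟨l1, e1⟩ | ⟨l1, e1⟩ <;> rcases h2 with ⟨l2, e2⟩ | ⟨l2, e2⟩
    · exact Prod.ext rfl (e1.symm.trans e2)
    · exact absurd l2 l1.asymm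
    · exact absurd l2 l1.asymm
    · exact Prod.ext rfl ((σ _).injective (e1.trans e2.symm))
  edges x y := fun ⟨h, _⟩ => ⟨x.1, y.1, h, rfl, rfl⟩

/-- Different families of permutations give different covers, so that a uniformly random family is
the same as a uniformly random element of the set of all covers `permCover G k σ`. -/
theorem permCover_injective (G : SimpleGraph V) (k : ℕ) :
    Function.Injective (permCover G k) := by
  intro σ τ h
  have hH : permCoverGraph G k σ = permCoverGraph G k τ := congrArg DPCover.H h
  have key : ∀ (a b : V) (hab : G.Adj a b), a < b →
      σ ⟨s(a, b), hab⟩ = τ ⟨s(a, b), hab⟩ := by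
    intro a b hab hlt
    ext1 i
    have h1 : (permCoverGraph G k σ).Adj (a, i) (b, σ ⟨s(a, b), hab⟩ i) :=
      ⟨hab, Or.inl ⟨hlt, rfl⟩⟩
    rw [hH] at h1
    obtain ⟨_, ⟨_, h2⟩ | ⟨h2, _⟩⟩ := h1
    · exact h2.symm
    · exact absurd h2 hlt.asymm
  funext ⟨e, he⟩
  induction e using Sym2.ind with
  | _ a b =>
    rcases lt_trichotomy a b with hlt | heq | hlt
    · exact key a b he hlt
    · subst heq
      exact absurd he G.irrefl
    · have := key b a (SimpleGraph.Adj.symm he) hlt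
      simpa only [Sym2.eq_swap] using this

/-- The probability that the finite graph `G` is colorable from a uniformly random full `k`-fold
cover: the number of families `σ` of permutations for which `G` is `H_σ`-colorable, divided by the
number of all families. -/
noncomputable def probDPColorable (G : SimpleGraph V) (k : ℕ) : ℝ :=
  (Nat.card {σ : G.edgeSet → Equiv.Perm (Fin k) // (permCover G k σ).Colorable} : ℝ) /
    (Nat.card (G.edgeSet → Equiv.Perm (Fin k)) : ℝ)

end RandomCover

section Threshold

variable {V : ℕ → Type u} [∀ l, Finite (V l)] [∀ l, LinearOrder (V l)]

/-- The sequence of graphs `G` is `κ`-DP-colorable with high probability. -/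
def DPColorableWhp (G : ∀ l, SimpleGraph (V l)) (κ : ℕ → ℕ) : Prop :=
  Tendsto (fun l => probDPColorable (G l) (κ l)) atTop (𝓝 1)

/-- The sequence of graphs `G` is non-`κ`-DP-colorable with high probability. -/
def NonDPColorableWhp (G : ∀ l, SimpleGraph (V l)) (κ : ℕ → ℕ) : Prop :=
  Tendsto (fun l => probDPColorable (G l) (κ l)) atTop (𝓝 0)

/-- `t` is a sharp DP-threshold function for the sequence of graphs `G`. -/
def IsSharpDPThreshold (G : ∀ l, SimpleGraph (V l)) (t : ℕ → ℝ) : Prop :=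
  ∀ ε : ℝ, 0 < ε → ∀ κ : ℕ → ℕ,
    ((∀ᶠ l in atTop, (κ l : ℝ) ≤ (1 - ε) * t l) → NonDPColorableWhp G κ) ∧
    ((∀ᶠ l in atTop, (1 + ε) * t l ≤ (κ l : ℝ)) → DPColorableWhp G κ)

end Threshold

/-! ### Uniformly random permutations: one or two prescribed values -/

section PermCount

open Finset

variable {α : Type*} [Fintype α] [DecidableEq α]

/-! Let X be the number of independent transversals and q = 1 - 1/k. Then E X = k^(mn) q^|E| with
|E| = mn·(m-1)n/2, roughly exp(mn(ln k - (m-1)n/(2k))). Near the threshold ln k ~ ln n, so the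
exponent changes sign at k ~ t(n).

Below the threshold E X → 0, and Markov's inequality suffices (`probDPColorable_le_first_moment`).

Above it, Cauchy–Schwarz gives P(X > 0) ≥ (E X)²/E X² (`pow_le_probDPColorable_mul`), and it remains
to bound E X²/(E X)² by 1 + o(1). For two choices f, g, the conditions at an edge are independent up
to a factor 1 + 1/(k-1)³, unless f and g agree at both ends, which costs a further factor 1/q. Hence
the ratio is at most (1 + 1/(k-1)³)^|E| times the mean of q^(-e(S)), where S is the agreement set of
random f, g and e(S) counts the edges inside S. The first factor tends to 1, since |E| is of order
n² and k at least of order n/ln n. Sets with |S|³ ≤ n have weight 1 + o(1). Larger ones are handled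
by a union bound, as f = g on S has probability k^(-|S|); their total is dominated by a geometric
series whose ratio tends to 0 (`sum_large_agreement_le`). -/

theorem card_perm_apply_eq (x y : α) :
    (Fintype.card α : ℝ) * (#{π : Equiv.Perm α | π x = y} : ℝ) = Fintype.card (Equiv.Perm α) := by
  -- Composing with the transposition of y and z matches the two sets, so all k values of π x are
  -- equally frequent.
  have h1 : ∀ z : α, #{π : Equiv.Perm α | π x = z} = #{π : Equiv.Perm α | π x = y} := by
    intro z
    refine card_bij' (fun π _ => Equiv.swap y z * π) (fun π _ => Equiv.swap y z * π) ?_ ?_ ?_ ?_ <;>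
      intro π hπ <;> simp_all [← mul_assoc]
  have h2 := card_eq_sum_card_fiberwise (s := (univ : Finset (Equiv.Perm α)))
    (t := univ) (f := fun π => π x) (fun _ _ => by simp)
  simp only [h1, sum_const, smul_eq_mul, card_univ] at h2
  exact_mod_cast h2.symm

theorem card_perm_apply_eq_and {x x' y y' : α} (hx : x ≠ x') (hy : y ≠ y') :
    ((Fintype.card α : ℝ) - 1) * (#{π : Equiv.Perm α | π x = y ∧ π x' = y'} : ℝ) =
      #{π : Equiv.Perm α | π x = y} := by
  have h1 : ∀ z ∈ univ.erase y, #{π : Equiv.Perm α | π x = y ∧ π x' = z} =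
      #{π : Equiv.Perm α | π x = y ∧ π x' = y'} := by
    intro z hz
    have hz : y ≠ z := by simpa [eq_comm] using hz
    refine card_bij' (fun π _ => Equiv.swap y' z * π) (fun π _ => Equiv.swap y' z * π) ?_ ?_ ?_ ?_ <;>
      intro π hπ <;> simp_all [← mul_assoc, Equiv.swap_apply_of_ne_of_ne]
  have h2 := card_eq_sum_card_fiberwise (s := ({π : Equiv.Perm α | π x = y} : Finset (Equiv.Perm α)))
    (t := univ.erase y) (f := fun π => π x') (fun π hπ => by
      simp only [coe_filter, mem_univ, true_and, Set.mem_ofPred_eq] at hπ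
      simp only [coe_erase, coe_univ, Set.mem_sdiff, Set.mem_univ, true_and, Set.mem_singleton_iff]
      intro h
      exact hx (π.injective (hπ.trans h.symm)))
  simp only [filter_filter] at h2
  rw [sum_congr rfl h1, sum_const, smul_eq_mul, card_erase_of_mem (mem_univ _), card_univ] at h2
  have : 1 ≤ Fintype.card α := Fintype.card_pos_iff.2 ⟨x⟩
  rw [h2]
  push_cast [Nat.cast_sub this]
  ring

theorem card_perm_apply_ne (x y : α) :
    (#{π : Equiv.Perm α | π x ≠ y} : ℝ) =
      Fintype.card (Equiv.Perm α) * (1 - 1 / (Fintype.card α : ℝ)) := by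
  have h0 : (Fintype.card α : ℝ) ≠ 0 := by
    have : 1 ≤ Fintype.card α := Fintype.card_pos_iff.2 ⟨x⟩
    positivity
  have h1 := card_perm_apply_eq x y
  have h2 : (#{π : Equiv.Perm α | π x = y} : ℝ) + #{π : Equiv.Perm α | π x ≠ y} =
      Fintype.card (Equiv.Perm α) := by
    exact_mod_cast card_filter_add_card_filter_not (s := univ) (fun π : Equiv.Perm α => π x = y)
  field_simp
  linear_combination (Fintype.card α : ℝ) * h2 - h1

/-- Inclusion–exclusion: each forbidden event has probability 1/k, and both together at most
1/(k(k-1)), or 0 if exactly one of x = x', y = y' holds. The last factor rewrites 1 - 2/k +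
1/(k(k-1)) exactly; its excess over 1 is cubic in 1/(k-1), small enough to survive a product over
order n² edges. -/
theorem card_perm_apply_ne_and_le (hα : 2 ≤ Fintype.card α) {x x' y y' : α}
    (h : ¬ (x = x' ∧ y = y')) :
    (#{π : Equiv.Perm α | π x ≠ y ∧ π x' ≠ y'} : ℝ) ≤
      Fintype.card (Equiv.Perm α) * ((1 - 1 / (Fintype.card α : ℝ)) ^ 2 *
        (1 + 1 / ((Fintype.card α : ℝ) - 1) ^ 3)) := by
  have hk : (2 : ℝ) ≤ Fintype.card α := by exact_mod_cast hα
  have e1 := card_perm_apply_eq x y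
  have e2 := card_perm_apply_eq x' y'
  have e3 : (Fintype.card α : ℝ) * (((Fintype.card α : ℝ) - 1) *
      (#{π : Equiv.Perm α | π x = y ∧ π x' = y'} : ℝ)) ≤ Fintype.card (Equiv.Perm α) := by
    by_cases hx : x = x'
    · have : #{π : Equiv.Perm α | π x = y ∧ π x' = y'} = 0 := by
        rw [card_eq_zero, filter_eq_empty_iff]
        rintro π - ⟨h1, h2⟩
        exact h ⟨hx, by rw [← h1, ← h2, hx]⟩
      simp [this]
    · by_cases hy : y = y'
      · have : #{π : Equiv.Perm α | π x = y ∧ π x' = y'} = 0 := by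
          rw [card_eq_zero, filter_eq_empty_iff]
          rintro π - ⟨h1, h2⟩
          exact hx (π.injective (by rw [h1, h2, hy]))
        simp [this]
      · rw [card_perm_apply_eq_and hx hy, e1]
  have e4 : (#{π : Equiv.Perm α | π x = y ∨ π x' = y'} : ℝ) +
      #{π : Equiv.Perm α | π x = y ∧ π x' = y'} =
      #{π : Equiv.Perm α | π x = y} + #{π : Equiv.Perm α | π x' = y'} := by
    rw [filter_or, filter_and]
    exact_mod_cast card_union_add_card_inter _ _
  have e5 : (#{π : Equiv.Perm α | π x = y ∨ π x' = y'} : ℝ) +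
      #{π : Equiv.Perm α | π x ≠ y ∧ π x' ≠ y'} = Fintype.card (Equiv.Perm α) := by
    have := card_filter_add_card_filter_not (s := univ)
      (fun π : Equiv.Perm α => π x = y ∨ π x' = y')
    simp only [not_or, card_univ] at this
    exact_mod_cast this
  set k : ℝ := (Fintype.card α : ℝ) with hkdef
  set M : ℝ := (Fintype.card (Equiv.Perm α) : ℝ) with hMdef
  set a : ℝ := (#{π : Equiv.Perm α | π x = y} : ℝ)
  set b : ℝ := (#{π : Equiv.Perm α | π x' = y'} : ℝ)
  set c : ℝ := (#{π : Equiv.Perm α | π x = y ∧ π x' = y'} : ℝ)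
  have hk1 : 0 < k - 1 := by linarith
  have hk0 : 0 < k := by linarith
  have ea : a = M / k := by rw [← e1]; field_simp
  have eb : b = M / k := by rw [← e2]; field_simp
  have ec : c ≤ M / (k * (k - 1)) := by
    rw [le_div_iff₀ (by positivity)]; linarith
  have e6 : (1 - 1 / k) ^ 2 * (1 + 1 / (k - 1) ^ 3) = 1 - 2 / k + 1 / (k * (k - 1)) := by
    field_simp
    ring
  rw [e6]
  have e7 : M * (1 - 2 / k + 1 / (k * (k - 1))) = M - M / k - M / k + M / (k * (k - 1)) := by ring
  linarith

end PermCount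

/-! ### Colorings as functions -/

section Moments

open Finset

variable {V : Type*} [LinearOrder V]

/-- `f` picks an independent transversal of the cover given by `σ`. -/
def IsProperFor (G : SimpleGraph V) {k : ℕ} (σ : G.edgeSet → Equiv.Perm (Fin k))
    (f : V → Fin k) : Prop :=
  ∀ e : G.edgeSet, σ e (f e.1.inf) ≠ f e.1.sup

/-- A transversal of the lists {a} × [k] is the graph of a function. Reading each edge from `inf` to
`sup` merges the two orientations of adjacency into one condition. -/
theorem permCover_colorable_iff (G : SimpleGraph V) {k : ℕ}
    (σ : G.edgeSet → Equiv.Perm (Fin k)) :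
    (permCover G k σ).Colorable ↔ ∃ f : V → Fin k, IsProperFor G σ f := by
  constructor
  · rintro ⟨T, hT, hI⟩
    choose g hg _ using hT
    have hg1 : ∀ a, (g a).1 = a := fun a => (hg a).1
    refine ⟨fun a => (g a).2, ?_⟩
    rintro ⟨e, he⟩ heq
    induction e using Sym2.ind with
    | _ a b =>
      wlog hab : a < b generalizing a b
      · have hne : a ≠ b := G.ne_of_adj he
        refine this b a (SimpleGraph.Adj.symm he) ?_ (lt_of_le_of_ne (not_lt.1 hab) hne.symm)
        simpa only [Sym2.eq_swap] using heq
      simp only [Sym2.inf_mk, Sym2.sup_mk, inf_eq_left.2 hab.le, sup_eq_right.2 hab.le] at heq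
      refine hI (hg a).2 (hg b).2 ?_ ?_
      · intro h
        have := congrArg Prod.fst h
        rw [hg1, hg1] at this
        exact hab.ne this
      · obtain ⟨⟨a', i⟩, ha⟩ : ∃ x, x = g a := ⟨_, rfl⟩
        obtain ⟨⟨b', j⟩, hb⟩ : ∃ x, x = g b := ⟨_, rfl⟩
        have h1 := hg1 a
        have h2 := hg1 b
        rw [← ha] at h1 heq ⊢
        rw [← hb] at h2 heq ⊢
        dsimp only at h1 h2
        subst h1 h2
        exact ⟨he, Or.inl ⟨hab, heq⟩⟩
  · rintro ⟨f, hf⟩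
    refine ⟨{x | x.2 = f x.1}, ?_, ?_⟩
    · intro a
      refine ⟨(a, f a), ⟨rfl, rfl⟩, ?_⟩
      rintro ⟨b, i⟩ ⟨h1, h2⟩
      change b = a at h1
      change i = f b at h2
      subst h1 h2
      rfl
    · have key : ∀ (a b : V) (h : G.Adj a b), a < b → σ ⟨s(a, b), h⟩ (f a) = f b → False := by
        intro a b h hab heq
        apply hf ⟨s(a, b), h⟩
        simpa [inf_eq_left.2 hab.le, sup_eq_right.2 hab.le] using heq
      rintro ⟨a, i⟩ hi ⟨b, j⟩ hj - ⟨h, h' | h'⟩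
      · change i = f a at hi
        change j = f b at hj
        subst hi hj
        exact key a b h h'.1 h'.2
      · change i = f a at hi
        change j = f b at hj
        subst hi hj
        exact key b a h.symm h'.1 h'.2

theorem probDPColorable_nonneg (G : SimpleGraph V) (k : ℕ) : 0 ≤ probDPColorable G k := by
  unfold probDPColorable
  positivity

end Moments

/-! ### First and second moments for a general graph -/

section MomentBounds

open Finset

variable {V : Type*} [LinearOrder V] [Fintype V]

open Classical in
/-- The edges of `G` with both ends in `S`. -/
noncomputable def edgesInside (G : SimpleGraph V) (S : Finset V) : Finset G.edgeSet :=
  {e | e.1.inf ∈ S ∧ e.1.sup ∈ S}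

open Classical in
theorem two_mul_card_edgesInside (G : SimpleGraph V) (S : Finset V) :
    2 * #(edgesInside G S) = #{p ∈ S ×ˢ S | G.Adj p.1 p.2} := by
  have h1 : #(edgesInside G S) = #{p ∈ S ×ˢ S | G.Adj p.1 p.2 ∧ p.1 < p.2} := by
    refine card_bij (fun e _ => (e.1.inf, e.1.sup)) ?_ ?_ ?_
    · rintro ⟨e, he⟩ h
      simp only [edgesInside, mem_filter, mem_univ, true_and] at h
      simp only [mem_filter, mem_product]
      refine ⟨h, ?_⟩
      clear h
      induction e using Sym2.ind with
      | _ a b =>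
        rcases lt_trichotomy a b with h | h | h
        · simpa [inf_eq_left.2 h.le, sup_eq_right.2 h.le, h] using he
        · exact absurd h (G.ne_of_adj he)
        · simpa [inf_eq_right.2 h.le, sup_eq_left.2 h.le, h] using SimpleGraph.Adj.symm he
    · rintro ⟨e, he⟩ - ⟨e', he'⟩ - h
      exact Subtype.ext (Sym2.inf_eq_inf_and_sup_eq_sup.1 (Prod.mk.inj h))
    · rintro ⟨a, b⟩ h
      simp only [mem_filter, mem_product] at h
      refine ⟨⟨s(a, b), h.2.1⟩, ?_, ?_⟩
      · simpa [edgesInside, inf_eq_left.2 h.2.2.le, sup_eq_right.2 h.2.2.le] using h.1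
      · simp [inf_eq_left.2 h.2.2.le, sup_eq_right.2 h.2.2.le]
  have h2 : #{p ∈ S ×ˢ S | G.Adj p.1 p.2 ∧ p.1 < p.2} =
      #{p ∈ S ×ˢ S | G.Adj p.1 p.2 ∧ ¬ p.1 < p.2} := by
    refine card_bij (fun p _ => p.swap) ?_ ?_ ?_
    · rintro ⟨a, b⟩ h
      simp only [mem_filter, mem_product, Prod.fst_swap, Prod.snd_swap] at h ⊢
      exact ⟨h.1.symm, h.2.1.symm, h.2.2.asymm⟩
    · intro p _ p' _ h
      exact Prod.swap_injective h
    · rintro ⟨a, b⟩ h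
      simp only [mem_filter, mem_product] at h
      refine ⟨(b, a), ?_, rfl⟩
      simp only [mem_filter, mem_product]
      exact ⟨h.1.symm, h.2.1.symm, lt_of_le_of_ne (not_lt.1 h.2.2) (G.ne_of_adj h.2.1).symm⟩
  have h3 := card_filter_add_card_filter_not (s := {p ∈ S ×ˢ S | G.Adj p.1 p.2})
    (fun p => p.1 < p.2)
  rw [filter_filter, filter_filter, ← h2, ← h1] at h3
  omega

/-- This is the independence of the permutations on different edges. -/
theorem card_filter_forall_apply {ι β : Type*} [Fintype ι] [DecidableEq ι] [Fintype β]
    [DecidableEq β] (P : ι → β → Prop) [∀ i, DecidablePred (P i)]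
    [DecidablePred fun σ : ι → β => ∀ i, P i (σ i)] :
    #{σ : ι → β | ∀ i, P i (σ i)} = ∏ i, #{x | P i x} := by
  rw [← Fintype.card_piFinset]
  congr 1
  ext σ
  simp

open Classical in
theorem card_isProperFor (G : SimpleGraph V) (k : ℕ) (f : V → Fin k) :
    (#{σ : G.edgeSet → Equiv.Perm (Fin k) | IsProperFor G σ f} : ℝ) =
      ((Fintype.card (Equiv.Perm (Fin k)) : ℝ) * (1 - 1 / (k : ℝ))) ^ Fintype.card G.edgeSet := by
  unfold IsProperFor
  rw [@card_filter_forall_apply _ _ _ _ _ _ (fun (e : G.edgeSet) (π : Equiv.Perm (Fin k)) =>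
    π (f e.1.inf) ≠ f e.1.sup) _ (fun _ => Classical.propDecidable _)]
  push_cast
  simp_rw [card_perm_apply_ne, prod_const, card_univ, Fintype.card_fin]

/-- The set of vertices where `f` and `g` agree. -/
def agreeSet {β : Type*} [DecidableEq β] (f g : V → β) : Finset V := {a | f a = g a}

open Classical in
theorem card_isProperFor_and_le (G : SimpleGraph V) {k : ℕ} (hk : 2 ≤ k) (f g : V → Fin k) :
    (#{σ : G.edgeSet → Equiv.Perm (Fin k) | IsProperFor G σ f ∧ IsProperFor G σ g} : ℝ) ≤
      ((Fintype.card (Equiv.Perm (Fin k)) : ℝ) * ((1 - 1 / (k : ℝ)) ^ 2 *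
        (1 + 1 / ((k : ℝ) - 1) ^ 3))) ^ Fintype.card G.edgeSet *
        (1 - 1 / (k : ℝ))⁻¹ ^ #(edgesInside G (agreeSet f g)) := by
  have hk' : (2 : ℝ) ≤ k := by exact_mod_cast hk
  have hq : 0 < 1 - 1 / (k : ℝ) := by
    rw [sub_pos, div_lt_one (by linarith)]; linarith
  have hk1 : 0 < (k : ℝ) - 1 := by linarith
  unfold IsProperFor
  simp_rw [← forall_and]
  rw [card_filter_forall_apply (fun (e : G.edgeSet) (π : Equiv.Perm (Fin k)) =>
    π (f e.1.inf) ≠ f e.1.sup ∧ π (g e.1.inf) ≠ g e.1.sup)]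
  have h1 : (1 - 1 / (k : ℝ))⁻¹ ^ #(edgesInside G (agreeSet f g)) =
      ∏ e : G.edgeSet, if e ∈ edgesInside G (agreeSet f g) then (1 - 1 / (k : ℝ))⁻¹ else 1 := by
    rw [prod_ite_mem, univ_inter, prod_const]
  rw [h1, ← card_univ (α := G.edgeSet), ← prod_const, ← prod_mul_distrib]
  push_cast
  refine prod_le_prod (fun _ _ => by positivity) fun e _ => ?_
  -- If f and g agree at both ends, the two conditions coincide and the factor is q = q²·q⁻¹.
  -- Otherwise the two forbidden assignments differ and the pair bound applies.
  split_ifs with he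
  · simp only [edgesInside, agreeSet, mem_filter, mem_univ, true_and] at he
    simp_rw [← he.1, ← he.2, and_self, card_perm_apply_ne, Fintype.card_fin]
    rw [sq, mul_assoc, mul_assoc, mul_assoc, mul_comm _ (1 - 1 / (k : ℝ))⁻¹]
    rw [← mul_assoc (1 - 1 / (k : ℝ)) (1 - 1 / (k : ℝ))⁻¹, mul_inv_cancel₀ hq.ne', one_mul]
    gcongr
    refine le_mul_of_one_le_right hq.le ?_
    have : 0 ≤ 1 / ((k : ℝ) - 1) ^ 3 := by positivity
    linarith
  · rw [mul_one]
    have := card_perm_apply_ne_and_le (α := Fin k) (by simpa using hk)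
      (x := f e.1.inf) (x' := g e.1.inf) (y := f e.1.sup) (y' := g e.1.sup)
      (by simpa [edgesInside, agreeSet] using he)
    simpa using this

open Classical in
theorem probDPColorable_eq (G : SimpleGraph V) (k : ℕ) :
    probDPColorable G k =
      (#{σ : G.edgeSet → Equiv.Perm (Fin k) | (permCover G k σ).Colorable} : ℝ) /
        (Fintype.card (Equiv.Perm (Fin k)) : ℝ) ^ Fintype.card G.edgeSet := by
  unfold probDPColorable
  rw [Nat.card_eq_fintype_card, Nat.card_eq_fintype_card, Fintype.card_subtype,
    Fintype.card_fun]
  push_cast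
  rfl

open Classical in
theorem sum_card_isProperFor (G : SimpleGraph V) (k : ℕ) :
    (∑ σ : G.edgeSet → Equiv.Perm (Fin k), (#{f | IsProperFor G σ f} : ℝ)) =
      (k : ℝ) ^ Fintype.card V *
      ((Fintype.card (Equiv.Perm (Fin k)) : ℝ) * (1 - 1 / (k : ℝ))) ^ Fintype.card G.edgeSet := by
  have h := sum_card_bipartiteAbove_eq_sum_card_bipartiteBelow
    (s := (univ : Finset (G.edgeSet → Equiv.Perm (Fin k)))) (t := (univ : Finset (V → Fin k)))
    (IsProperFor G)
  simp only [bipartiteAbove, bipartiteBelow] at h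
  have h' : (∑ σ : G.edgeSet → Equiv.Perm (Fin k), (#{f | IsProperFor G σ f} : ℝ)) =
    ∑ f : V → Fin k, (#{σ : G.edgeSet → Equiv.Perm (Fin k) | IsProperFor G σ f} : ℝ) := by
    exact_mod_cast h
  rw [h']
  simp [card_isProperFor]

theorem probDPColorable_le_one (G : SimpleGraph V) (k : ℕ) : probDPColorable G k ≤ 1 := by
  classical
  unfold probDPColorable
  refine div_le_one_of_le₀ ?_ (by positivity)
  exact_mod_cast Nat.card_le_card_of_injective _ Subtype.val_injective

open Classical in
-- Markov's inequality: a colorable cover admits at least one proper `f`.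
theorem probDPColorable_le_first_moment (G : SimpleGraph V) (k : ℕ) :
    probDPColorable G k ≤
      (k : ℝ) ^ Fintype.card V * (1 - 1 / (k : ℝ)) ^ #(edgesInside G univ) := by
  have hE : #(edgesInside G univ) = Fintype.card G.edgeSet := by simp [edgesInside]
  have hM : (0 : ℝ) < Fintype.card (Equiv.Perm (Fin k)) := by exact_mod_cast Fintype.card_pos
  rw [probDPColorable_eq, div_le_iff₀ (by positivity), hE, mul_assoc, ← mul_pow,
    mul_comm (1 - 1 / (k : ℝ)), ← sum_card_isProperFor, card_filter]
  push_cast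
  refine sum_le_sum fun σ _ => ?_
  split_ifs with h
  · obtain ⟨f, hf⟩ := (permCover_colorable_iff G σ).1 h
    exact_mod_cast card_pos.2 ⟨f, by simpa using hf⟩
  · positivity

open Classical in
theorem sum_card_isProperFor_sq_le (G : SimpleGraph V) {k : ℕ} (hk : 2 ≤ k) :
    (∑ σ : G.edgeSet → Equiv.Perm (Fin k), (#{f | IsProperFor G σ f} : ℝ) ^ 2) ≤
      ((Fintype.card (Equiv.Perm (Fin k)) : ℝ) * ((1 - 1 / (k : ℝ)) ^ 2 *
        (1 + 1 / ((k : ℝ) - 1) ^ 3))) ^ Fintype.card G.edgeSet *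
      ∑ p : (V → Fin k) × (V → Fin k),
        (1 - 1 / (k : ℝ))⁻¹ ^ #(edgesInside G (agreeSet p.1 p.2)) := by
  have h := sum_card_bipartiteAbove_eq_sum_card_bipartiteBelow
    (s := (univ : Finset (G.edgeSet → Equiv.Perm (Fin k))))
    (t := (univ : Finset ((V → Fin k) × (V → Fin k))))
    (fun σ p => IsProperFor G σ p.1 ∧ IsProperFor G σ p.2)
  simp only [bipartiteAbove, bipartiteBelow] at h
  have h1 : ∀ σ : G.edgeSet → Equiv.Perm (Fin k), (#{f | IsProperFor G σ f}) ^ 2 =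
      #{p : (V → Fin k) × (V → Fin k) | IsProperFor G σ p.1 ∧ IsProperFor G σ p.2} := by
    intro σ
    rw [sq, ← card_product, ← filter_product, univ_product_univ]
  have h2 : (∑ σ : G.edgeSet → Equiv.Perm (Fin k), (#{f | IsProperFor G σ f} : ℝ) ^ 2) =
      ∑ p : (V → Fin k) × (V → Fin k), (#{σ : G.edgeSet → Equiv.Perm (Fin k) |
        IsProperFor G σ p.1 ∧ IsProperFor G σ p.2} : ℝ) := by
    simp_rw [← h1] at h
    exact_mod_cast h
  rw [h2, mul_sum]
  exact sum_le_sum fun p _ => card_isProperFor_and_le G hk p.1 p.2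

open Classical in
/-- The second moment bound. -/
theorem pow_le_probDPColorable_mul (G : SimpleGraph V) {k : ℕ} (hk : 2 ≤ k) :
    ((k : ℝ) ^ Fintype.card V) ^ 2 ≤ probDPColorable G k *
      ((1 + 1 / ((k : ℝ) - 1) ^ 3) ^ #(edgesInside G univ) *
      ∑ p : (V → Fin k) × (V → Fin k),
        (1 - 1 / (k : ℝ))⁻¹ ^ #(edgesInside G (agreeSet p.1 p.2))) := by
  have hE : #(edgesInside G univ) = Fintype.card G.edgeSet := by simp [edgesInside]
  have hM : (0 : ℝ) < Fintype.card (Equiv.Perm (Fin k)) := by exact_mod_cast Fintype.card_pos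
  have hk' : (2 : ℝ) ≤ k := by exact_mod_cast hk
  have hq : 0 < 1 - 1 / (k : ℝ) := by
    rw [sub_pos, div_lt_one (by linarith)]; linarith
  -- Cauchy–Schwarz for the product of X with the indicator of X > 0, which is X itself.
  have h1 := sum_mul_sq_le_sq_mul_sq univ
    (fun σ : G.edgeSet → Equiv.Perm (Fin k) => if (permCover G k σ).Colorable then (1 : ℝ) else 0)
    (fun σ => (#{f | IsProperFor G σ f} : ℝ))
  have h2 : ∀ σ : G.edgeSet → Equiv.Perm (Fin k),
      (if (permCover G k σ).Colorable then (1 : ℝ) else 0) * (#{f | IsProperFor G σ f} : ℝ) =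
      (#{f | IsProperFor G σ f} : ℝ) := by
    intro σ
    split_ifs with h
    · rw [one_mul]
    · rw [permCover_colorable_iff, not_exists] at h
      simp [h]
  have h3 : ∀ σ : G.edgeSet → Equiv.Perm (Fin k),
      (if (permCover G k σ).Colorable then (1 : ℝ) else 0) ^ 2 =
      if (permCover G k σ).Colorable then (1 : ℝ) else 0 := by
    intro σ; split_ifs <;> simp
  simp_rw [h2, h3] at h1
  rw [sum_card_isProperFor, sum_boole] at h1
  have h4 := h1.trans (mul_le_mul_of_nonneg_left (sum_card_isProperFor_sq_le G hk) (by positivity))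
  rw [probDPColorable_eq, hE]
  set M : ℝ := (Fintype.card (Equiv.Perm (Fin k)) : ℝ) with hMdef
  set E := Fintype.card G.edgeSet
  set S := ∑ p : (V → Fin k) × (V → Fin k),
        (1 - 1 / (k : ℝ))⁻¹ ^ #(edgesInside G (agreeSet p.1 p.2))
  set C : ℝ := (#{σ : G.edgeSet → Equiv.Perm (Fin k) | (permCover G k σ).Colorable} : ℝ)
  set q := 1 - 1 / (k : ℝ)
  set d := 1 + 1 / ((k : ℝ) - 1) ^ 3
  have h5 : 0 < (M ^ E * q ^ E) ^ 2 := by positivity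
  refine le_of_mul_le_mul_right ?_ h5
  have h6 : C / M ^ E * (d ^ E * S) * (M ^ E * q ^ E) ^ 2 = C * ((M * (q ^ 2 * d)) ^ E * S) := by
    field_simp
    ring_nf
  rw [h6, ← mul_pow M, ← mul_pow]
  exact h4

open Classical in
-- Agreement sets outside P contribute at most B per pair. For S in P, agreement exactly on S is
-- relaxed to agreement at least on S, and then each f leaves k^(|V| - |S|) choices of g.
theorem sum_agreeSet_le {k : ℕ} (hk : 1 ≤ k) (F : Finset V → ℝ) (hF : ∀ S, 0 ≤ F S)
    (P : Finset V → Prop) [DecidablePred P] (B : ℝ) (hB : 0 ≤ B) (hPB : ∀ S, ¬ P S → F S ≤ B) :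
    ∑ p : (V → Fin k) × (V → Fin k), F (agreeSet p.1 p.2) ≤
      ((k : ℝ) ^ Fintype.card V) ^ 2 * (B + ∑ S with P S, F S / (k : ℝ) ^ #S) := by
  have hk0 : (0 : ℝ) < k := by exact_mod_cast hk
  have h1 : ∀ p : (V → Fin k) × (V → Fin k), F (agreeSet p.1 p.2) ≤
      B + ∑ S with P S, if (∀ a ∈ S, p.2 a = p.1 a) then F S else 0 := by
    intro p
    have h0 : ∀ S ∈ ({S | P S} : Finset (Finset V)),
        0 ≤ if (∀ a ∈ S, p.2 a = p.1 a) then F S else 0 := fun S _ => by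
      split_ifs
      exacts [hF S, le_rfl]
    by_cases hP : P (agreeSet p.1 p.2)
    · have h2 := single_le_sum h0 (a := agreeSet p.1 p.2) (by simpa using hP)
      rw [if_pos (fun a ha => by simpa [agreeSet, eq_comm] using ha)] at h2
      linarith
    · have := hPB _ hP
      have := sum_nonneg h0
      linarith
  have h2 : ∀ (f : V → Fin k) (S : Finset V),
      (#{g : V → Fin k | ∀ a ∈ S, g a = f a} : ℝ) = (k : ℝ) ^ Fintype.card V / (k : ℝ) ^ #S := by
    intro f S
    have h3 : ({g : V → Fin k | ∀ a ∈ S, g a = f a} : Finset (V → Fin k)) =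
        Fintype.piFinset fun a => if a ∈ S then {f a} else univ := by
      ext g
      simp only [mem_filter, mem_univ, true_and, Fintype.mem_piFinset]
      refine forall_congr' fun a => ?_
      split_ifs with h <;> simp [h]
    have h4 : ∀ a, #(if a ∈ S then {f a} else (univ : Finset (Fin k))) =
        if a ∈ Sᶜ then k else 1 := by
      intro a
      by_cases h : a ∈ S <;> simp [h]
    rw [h3, Fintype.card_piFinset]
    simp_rw [h4]
    rw [prod_ite_mem, univ_inter, prod_const, eq_div_iff (by positivity), card_compl]
    push_cast
    rw [← pow_add, Nat.sub_add_cancel (card_le_univ S)]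
  refine (sum_le_sum fun p _ => h1 p).trans (le_of_eq ?_)
  rw [sum_add_distrib, sum_const, card_univ, sum_comm, mul_add, mul_sum]
  congr 1
  · simp only [Fintype.card_prod, Fintype.card_fun, Fintype.card_fin, nsmul_eq_mul]
    push_cast
    ring
  · refine sum_congr rfl fun S _ => ?_
    rw [Fintype.sum_prod_type]
    simp_rw [← sum_filter, sum_const, nsmul_eq_mul, h2]
    rw [sum_const, card_univ, Fintype.card_fun, Fintype.card_fin, nsmul_eq_mul]
    push_cast
    ring

open Classical in
/-- If every vertex set `S` that satisfies `P` is handled by a union bound and all other sets have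
a small weight, then the second moment method applies. -/
theorem one_le_probDPColorable_mul (G : SimpleGraph V) {k : ℕ} (hk : 2 ≤ k)
    (P : Finset V → Prop) [DecidablePred P] (B : ℝ) (hB : 0 ≤ B)
    (hPB : ∀ S, ¬ P S → (1 - 1 / (k : ℝ))⁻¹ ^ #(edgesInside G S) ≤ B) :
    1 ≤ probDPColorable G k * ((1 + 1 / ((k : ℝ) - 1) ^ 3) ^ #(edgesInside G univ) *
      (B + ∑ S with P S, (1 - 1 / (k : ℝ))⁻¹ ^ #(edgesInside G S) / (k : ℝ) ^ #S)) := by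
  have hk' : (2 : ℝ) ≤ k := by exact_mod_cast hk
  have hq : 0 < 1 - 1 / (k : ℝ) := by
    rw [sub_pos, div_lt_one (by linarith)]; linarith
  have hk1 : 0 < (k : ℝ) - 1 := by linarith
  have h1 := pow_le_probDPColorable_mul G hk
  have h2 := sum_agreeSet_le (by omega : 1 ≤ k)
    (fun S => (1 - 1 / (k : ℝ))⁻¹ ^ #(edgesInside G S)) (fun S => by positivity) P B hB hPB
  have h3 : 0 < ((k : ℝ) ^ Fintype.card V) ^ 2 := by positivity
  have h4 := h1.trans (mul_le_mul_of_nonneg_left (mul_le_mul_of_nonneg_left h2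
    (by positivity)) (probDPColorable_nonneg G k))
  refine le_of_mul_le_mul_left ?_ h3
  linarith

end MomentBounds

/-! ### Edge counts in complete multipartite graphs -/

section CompleteMultipartite

open Finset

open Classical in
theorem two_mul_card_edgesInside_completeMultipartite (m n : ℕ)
    (ord : LinearOrder (Σ _ : Fin m, Fin n)) (S : Finset (Σ _ : Fin m, Fin n)) :
    2 * (#(edgesInside (SimpleGraph.completeMultipartiteGraph (fun _ : Fin m => Fin n)) S) : ℝ) =
      (#S : ℝ) ^ 2 - ∑ i : Fin m, (#{x ∈ S | x.1 = i} : ℝ) ^ 2 := by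
  have h1 := two_mul_card_edgesInside
    (SimpleGraph.completeMultipartiteGraph (fun _ : Fin m => Fin n)) S
  have h2 := card_filter_add_card_filter_not (s := S ×ˢ S) (fun p => p.1.1 = p.2.1)
  have h3 : #{p ∈ S ×ˢ S | p.1.1 = p.2.1} = ∑ i : Fin m, #{x ∈ S | x.1 = i} ^ 2 := by
    rw [card_eq_sum_card_fiberwise (t := univ) (f := fun p => p.1.1) (fun _ _ => by simp)]
    refine sum_congr rfl fun i _ => ?_
    rw [sq, ← card_product, ← filter_product, filter_filter]
    congr 1
    refine filter_congr fun p _ => ?_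
    constructor
    · rintro ⟨h, rfl⟩; exact ⟨rfl, h.symm⟩
    · rintro ⟨h, h'⟩; exact ⟨h.trans h'.symm, h⟩
  replace h1 : 2 * #(edgesInside
      (SimpleGraph.completeMultipartiteGraph (fun _ : Fin m => Fin n)) S) =
      #{p ∈ S ×ˢ S | ¬ p.1.1 = p.2.1} := by
    refine h1.trans (congrArg card (Finset.ext fun p => ?_))
    simp [SimpleGraph.completeMultipartiteGraph]
  rw [h3, ← h1, card_product] at h2
  rw [eq_sub_iff_add_eq, sq]
  rw [add_comm] at h2
  exact_mod_cast h2

open Classical in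
-- By Cauchy–Schwarz the squared part sizes of S sum to at least |S|²/m; the balanced case is
-- extremal.
theorem card_edgesInside_completeMultipartite_le {m : ℕ} (hm : 1 ≤ m) (n : ℕ)
    (ord : LinearOrder (Σ _ : Fin m, Fin n)) (S : Finset (Σ _ : Fin m, Fin n)) :
    (#(edgesInside (SimpleGraph.completeMultipartiteGraph (fun _ : Fin m => Fin n)) S) : ℝ) ≤
      ((m : ℝ) - 1) * (#S : ℝ) ^ 2 / (2 * m) := by
  have h1 := two_mul_card_edgesInside_completeMultipartite m n ord S
  have h2 : (#S : ℝ) = ∑ i : Fin m, (#{x ∈ S | x.1 = i} : ℝ) := by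
    exact_mod_cast card_eq_sum_card_fiberwise (s := S) (t := univ) (f := fun x => x.1)
      (fun _ _ => by simp)
  have h3 := sq_sum_le_card_mul_sum_sq (s := univ) (f := fun i : Fin m => (#{x ∈ S | x.1 = i} : ℝ))
  rw [← h2, card_univ, Fintype.card_fin] at h3
  have hm' : (0 : ℝ) < m := by exact_mod_cast hm
  rw [le_div_iff₀ (by positivity)]
  linear_combination (m : ℝ) * h1 + h3

theorem card_edgesInside_univ_completeMultipartite (m n : ℕ)
    (ord : LinearOrder (Σ _ : Fin m, Fin n)) :
    (#(edgesInside (SimpleGraph.completeMultipartiteGraph (fun _ : Fin m => Fin n)) univ) : ℝ) =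
      (m * n : ℝ) * (((m : ℝ) - 1) * n / 2) := by
  classical
  have h1 := two_mul_card_edgesInside_completeMultipartite m n ord univ
  have h2 : ∀ i : Fin m, #{x : (Σ _ : Fin m, Fin n) | x.1 = i} = n := by
    intro i
    have : ({x : (Σ _ : Fin m, Fin n) | x.1 = i} : Finset _) =
        univ.map ⟨fun j : Fin n => (⟨i, j⟩ : Σ _ : Fin m, Fin n), fun a b h => by simpa using h⟩ := by
      ext ⟨a, b⟩
      simp only [mem_filter, mem_univ, true_and, Finset.mem_map]
      constructor
      · rintro rfl; exact ⟨b, rfl⟩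
      · rintro ⟨j, hj⟩; exact (congrArg Sigma.fst hj).symm
    rw [this, card_map, card_univ, Fintype.card_fin]
  have h3 : #(univ : Finset (Σ _ : Fin m, Fin n)) = m * n := by simp
  rw [h3] at h1
  simp only [h2, sum_const, card_univ, Fintype.card_fin, nsmul_eq_mul] at h1
  push_cast at h1
  linarith

end CompleteMultipartite

/-! ### Asymptotic bounds on the second moment -/

section Estimates

open Finset Real

theorem choose_le_exp_mul_div_pow (N : ℕ) {s : ℕ} (hs : 1 ≤ s) :
    (N.choose s : ℝ) ≤ (exp 1 * N / s) ^ s := by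
  have hs' : (0 : ℝ) < s := by exact_mod_cast hs
  have h1 := Nat.choose_le_pow_div (α := ℝ) s N
  have h2 := pow_div_factorial_le_exp (s : ℝ) hs'.le s
  have h3 : exp (s : ℝ) = exp 1 ^ s := by rw [← exp_nat_mul, mul_one]
  have h4 : (0 : ℝ) < s.factorial := by exact_mod_cast s.factorial_pos
  refine h1.trans ?_
  rw [div_pow, mul_pow, ← h3, div_le_div_iff₀ h4 (by positivity)]
  rw [div_le_iff₀ h4] at h2
  calc (N : ℝ) ^ s * s ^ s ≤ N ^ s * (exp s * s.factorial) := by gcongr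
    _ = _ := by ring

theorem one_add_pow_le_exp_mul {x : ℝ} (hx : 0 ≤ x) (e : ℕ) : (1 + x) ^ e ≤ exp (e * x) := by
  rw [exp_nat_mul]
  gcongr
  linarith [add_one_le_exp x]

/-- The ratio of the geometric series that dominates the contribution of large agreement sets. -/
noncomputable def tailRatio (m n : ℕ) (c : ℝ) : ℝ :=
  2 * exp 1 * m * (log n * (n : ℝ) ^ (-(1 / 12) : ℝ)) + 8 * exp 1 * (log n * (n : ℝ) ^ (c - 1))

theorem base_le_tailRatio {m n s : ℕ} (hm : 1 ≤ m) (hn : 1 ≤ n) {c : ℝ} (hc0 : 0 < c) (hc1 : c ≤ 1)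
    (hs : n < s ^ 3) (hsN : s ≤ m * n) :
    2 * exp 1 * m * log n / s * (n : ℝ) ^ (c * s / (m * n)) ≤ tailRatio m n c := by
  have hn' : (1 : ℝ) ≤ n := by exact_mod_cast hn
  have hn0 : (0 : ℝ) < n := by linarith
  have hm0 : (0 : ℝ) < m := by exact_mod_cast hm
  have hL : 0 ≤ log n := log_nonneg hn'
  have hs0 : 0 < s := Nat.pos_of_ne_zero (by rintro rfl; simp at hs)
  have hs0' : (0 : ℝ) < s := by exact_mod_cast hs0
  have hsN' : (s : ℝ) ≤ m * n := by exact_mod_cast hsN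
  unfold tailRatio
  -- Up to mn/4 the power of n is at most 1/4, while s ≥ n^(1/3), leaving n^(-1/12). Beyond mn/4 the
  -- denominator s is linear in n, leaving n^(c-1).
  by_cases h : (s : ℝ) ≤ m * n / 4
  · refine le_add_of_le_of_nonneg ?_ (by positivity)
    have h1 : (n : ℝ) ^ (1 / 3 : ℝ) ≤ s := by
      have : (n : ℝ) ≤ (s : ℝ) ^ 3 := by exact_mod_cast hs.le
      calc (n : ℝ) ^ (1 / 3 : ℝ) ≤ ((s : ℝ) ^ 3) ^ (1 / 3 : ℝ) := by gcongr
        _ = s := by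
          rw [← rpow_natCast, ← rpow_mul hs0'.le]
          norm_num
    have h2 : (n : ℝ) ^ (c * s / (m * n)) ≤ (n : ℝ) ^ (1 / 4 : ℝ) := by
      refine rpow_le_rpow_of_exponent_le hn' ?_
      rw [div_le_iff₀ (by positivity)]
      nlinarith
    calc 2 * exp 1 * m * log n / s * (n : ℝ) ^ (c * s / (m * n))
        ≤ 2 * exp 1 * m * log n / (n : ℝ) ^ (1 / 3 : ℝ) * (n : ℝ) ^ (1 / 4 : ℝ) := by gcongr
      _ = 2 * exp 1 * m * (log n * ((n : ℝ) ^ (1 / 4 : ℝ) / (n : ℝ) ^ (1 / 3 : ℝ))) := by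
        field_simp
      _ = _ := by
        rw [← rpow_sub hn0]
        norm_num
  · push Not at h
    refine le_add_of_nonneg_of_le (by positivity) ?_
    have h1 : (n : ℝ) ^ (c * s / (m * n)) ≤ (n : ℝ) ^ c := by
      refine rpow_le_rpow_of_exponent_le hn' ?_
      rw [div_le_iff₀ (by positivity)]
      gcongr
    calc 2 * exp 1 * m * log n / s * (n : ℝ) ^ (c * s / (m * n))
        ≤ 2 * exp 1 * m * log n / (m * n / 4) * (n : ℝ) ^ c := by gcongr
      _ = 8 * exp 1 * (log n * ((n : ℝ) ^ c / (n : ℝ) ^ (1 : ℝ))) := by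
        rw [rpow_one]
        field_simp
        ring
      _ = _ := by rw [← rpow_sub hn0]

/-- For n > 1, `hkc` says t(n) ≤ c(k-1). This turns the exponential into (n^(cs/(mn)))^s, so the
whole term becomes an s-th power. -/
theorem choose_mul_exp_div_pow_le {m n s k : ℕ} (hm : 2 ≤ m) (hn : 1 ≤ n) (hk : 2 ≤ k) {c : ℝ}
    (hc0 : 0 < c) (hc1 : c ≤ 1)
    (hkc : ((m : ℝ) - 1) * n / 2 ≤ c * log n * ((k : ℝ) - 1))
    (hs : n < s ^ 3) (hsN : s ≤ m * n) :
    ((m * n).choose s : ℝ) *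
      (exp (((m : ℝ) - 1) * (s : ℝ) ^ 2 / (2 * m) / ((k : ℝ) - 1)) / (k : ℝ) ^ s) ≤
      tailRatio m n c ^ s := by
  have hn' : (1 : ℝ) ≤ n := by exact_mod_cast hn
  have hn0 : (0 : ℝ) < n := by linarith
  have hm2 : (2 : ℝ) ≤ m := by exact_mod_cast hm
  have hm0 : (0 : ℝ) < m := by linarith
  have hL : 0 ≤ log n := log_nonneg hn'
  have hs0 : 0 < s := Nat.pos_of_ne_zero (by rintro rfl; simp at hs)
  have hs0' : (0 : ℝ) < s := by exact_mod_cast hs0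
  have hk2 : (2 : ℝ) ≤ k := by exact_mod_cast hk
  have hk1 : 0 < (k : ℝ) - 1 := by linarith
  have h1 : exp (((m : ℝ) - 1) * (s : ℝ) ^ 2 / (2 * m) / ((k : ℝ) - 1)) ≤
      ((n : ℝ) ^ (c * s / (m * n))) ^ s := by
    rw [rpow_def_of_pos hn0, ← exp_nat_mul, exp_le_exp, div_le_iff₀ hk1]
    calc ((m : ℝ) - 1) * (s : ℝ) ^ 2 / (2 * m)
        = ((s : ℝ) ^ 2 / (m * n)) * (((m : ℝ) - 1) * n / 2) := by field_simp
      _ ≤ ((s : ℝ) ^ 2 / (m * n)) * (c * log n * ((k : ℝ) - 1)) := by gcongr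
      _ = _ := by field_simp
  have h2 : 1 / (k : ℝ) ≤ 2 * log n / n := by
    rw [div_le_div_iff₀ (by linarith) hn0]
    have a1 : (n : ℝ) / 2 ≤ ((m : ℝ) - 1) * n / 2 := by nlinarith
    have a2 : c * log n * ((k : ℝ) - 1) ≤ 1 * log n * k := by
      gcongr
      linarith
    linarith
  calc ((m * n).choose s : ℝ) *
      (exp (((m : ℝ) - 1) * (s : ℝ) ^ 2 / (2 * m) / ((k : ℝ) - 1)) / (k : ℝ) ^ s)
      ≤ (exp 1 * (m * n : ℕ) / s) ^ s * (((n : ℝ) ^ (c * s / (m * n))) ^ s / (k : ℝ) ^ s) := by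
        gcongr
        exact choose_le_exp_mul_div_pow _ hs0
    _ = (exp 1 * (m * n : ℕ) / s * (n : ℝ) ^ (c * s / (m * n)) * (1 / k)) ^ s := by
        rw [mul_pow, mul_pow, div_pow 1, one_pow]
        ring
    _ ≤ (exp 1 * (m * n : ℕ) / s * (n : ℝ) ^ (c * s / (m * n)) * (2 * log n / n)) ^ s := by
        gcongr
    _ = (2 * exp 1 * m * log n / s * (n : ℝ) ^ (c * s / (m * n))) ^ s := by
        congr 1
        push_cast
        field_simp
    _ ≤ _ := by
        gcongr
        exact base_le_tailRatio (by omega) hn hc0 hc1 hs hsN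

theorem sum_range_pow_succ_le {r : ℝ} (h0 : 0 ≤ r) (h1 : r ≤ 1 / 2) (N : ℕ) :
    ∑ s ∈ range N, r ^ (s + 1) ≤ 2 * r := by
  have h2 : ∑ s ∈ range N, r ^ s ≤ 2 := by
    calc ∑ s ∈ range N, r ^ s ≤ ∑ s ∈ range N, (1 / 2 : ℝ) ^ s := by gcongr
      _ ≤ 2 := sum_geometric_two_le N
  simp_rw [pow_succ]
  rw [← sum_mul]
  gcongr

open Classical in
theorem sum_large_agreement_le {m n k : ℕ} (hm : 2 ≤ m) (hn : 1 ≤ n) (hk : 2 ≤ k) {c : ℝ}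
    (hc0 : 0 < c) (hc1 : c ≤ 1)
    (hkc : ((m : ℝ) - 1) * n / 2 ≤ c * log n * ((k : ℝ) - 1))
    (hr : tailRatio m n c ≤ 1 / 2) (ord : LinearOrder (Σ _ : Fin m, Fin n)) :
    ∑ S : Finset (Σ _ : Fin m, Fin n) with n < #S ^ 3, (1 - 1 / (k : ℝ))⁻¹ ^
      #(edgesInside (SimpleGraph.completeMultipartiteGraph (fun _ : Fin m => Fin n)) S) /
        (k : ℝ) ^ #S ≤ 2 * tailRatio m n c := by
  have hm2 : (2 : ℝ) ≤ m := by exact_mod_cast hm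
  have hk2 : (2 : ℝ) ≤ k := by exact_mod_cast hk
  have hk1 : 0 < (k : ℝ) - 1 := by linarith
  have hr0 : 0 ≤ tailRatio m n c := by
    have : 0 ≤ log n := log_natCast_nonneg n
    unfold tailRatio
    positivity
  set h : ℕ → ℝ := fun s => if n < s ^ 3 then
    exp (((m : ℝ) - 1) * (s : ℝ) ^ 2 / (2 * m) / ((k : ℝ) - 1)) / (k : ℝ) ^ s else 0 with hh
  have hq : (1 - 1 / (k : ℝ))⁻¹ = 1 + 1 / ((k : ℝ) - 1) := by field_simp; ring
  have h1 : ∀ S : Finset (Σ _ : Fin m, Fin n), (if n < #S ^ 3 then (1 - 1 / (k : ℝ))⁻¹ ^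
      #(edgesInside (SimpleGraph.completeMultipartiteGraph (fun _ : Fin m => Fin n)) S) /
        (k : ℝ) ^ #S else 0) ≤ h #S := by
    intro S
    simp only [hh]
    split_ifs
    · rw [hq]
      gcongr
      refine (one_add_pow_le_exp_mul (by positivity) _).trans ?_
      rw [exp_le_exp, mul_one_div]
      gcongr
      exact card_edgesInside_completeMultipartite_le (by omega) n ord S
    · exact le_rfl
  rw [sum_filter]
  refine (sum_le_sum fun S _ => h1 S).trans ?_
  have h2 := sum_powerset_apply_card h (x := (univ : Finset (Σ _ : Fin m, Fin n)))
  rw [powerset_univ] at h2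
  have h3 : #(univ : Finset (Σ _ : Fin m, Fin n)) = m * n := by simp
  rw [h2, h3, sum_range_succ']
  -- The empty set is not large, so the series starts at s = 1 and is of order r instead of
  -- constant.
  have h4 : h 0 = 0 := by simp [hh]
  rw [h4, smul_zero, add_zero]
  refine le_trans (sum_le_sum fun s hs => ?_) (sum_range_pow_succ_le hr0 hr (m * n))
  rw [mem_range] at hs
  simp only [hh, nsmul_eq_mul]
  split_ifs with hc
  · exact choose_mul_exp_div_pow_le hm hn hk hc0 hc1 hkc hc hs
  · rw [mul_zero]; positivity

/-- The bound on the ratio of the second moment to the square of the first moment. -/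
noncomputable def momentRatioBound (m n : ℕ) (c : ℝ) : ℝ :=
  exp (8 * m ^ 2 * (log n ^ 3 / n)) *
    (exp (2 * (log n * (n : ℝ) ^ (-(1 / 3) : ℝ))) + 2 * tailRatio m n c)

theorem one_le_probDPColorable_mul_momentRatioBound {m n k : ℕ} (hm : 2 ≤ m) (hn : 1 ≤ n)
    (hk : 2 ≤ k) {c : ℝ} (hc0 : 0 < c) (hc1 : c ≤ 1)
    (hkc : ((m : ℝ) - 1) * n / 2 ≤ c * log n * ((k : ℝ) - 1))
    (hr : tailRatio m n c ≤ 1 / 2) (ord : LinearOrder (Σ _ : Fin m, Fin n)) :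
    1 ≤ probDPColorable (SimpleGraph.completeMultipartiteGraph (fun _ : Fin m => Fin n)) k *
      momentRatioBound m n c := by
  classical
  have hn' : (1 : ℝ) ≤ n := by exact_mod_cast hn
  have hn0 : (0 : ℝ) < n := by linarith
  have hm2 : (2 : ℝ) ≤ m := by exact_mod_cast hm
  have hL : 0 ≤ log n := log_nonneg hn'
  have hk2 : (2 : ℝ) ≤ k := by exact_mod_cast hk
  have hk1 : 0 < (k : ℝ) - 1 := by linarith
  have hq : (1 - 1 / (k : ℝ))⁻¹ = 1 + 1 / ((k : ℝ) - 1) := by field_simp; ring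
  have hy : 1 / ((k : ℝ) - 1) ≤ 2 * log n / n := by
    rw [div_le_div_iff₀ hk1 hn0]
    have a1 : (n : ℝ) / 2 ≤ ((m : ℝ) - 1) * n / 2 := by nlinarith
    have a2 : c * log n * ((k : ℝ) - 1) ≤ 1 * log n * (k - 1) := by gcongr
    linarith
  -- Here e(S) ≤ |S|² ≤ n^(2/3), while 1/(k-1) ≤ 2 ln n / n, so the exponent is of order n^(-1/3) ln
  -- n.
  have hsmall : ∀ S : Finset (Σ _ : Fin m, Fin n), ¬ n < #S ^ 3 → (1 - 1 / (k : ℝ))⁻¹ ^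
      #(edgesInside (SimpleGraph.completeMultipartiteGraph (fun _ : Fin m => Fin n)) S) ≤
      exp (2 * (log n * (n : ℝ) ^ (-(1 / 3) : ℝ))) := by
    intro S hS
    rw [hq]
    refine (one_add_pow_le_exp_mul (by positivity) _).trans ?_
    rw [exp_le_exp]
    have b1 := card_edgesInside_completeMultipartite_le (by omega : 1 ≤ m) n ord S
    have b2 : ((m : ℝ) - 1) * (#S : ℝ) ^ 2 / (2 * m) ≤ (#S : ℝ) ^ 2 := by
      rw [div_le_iff₀ (by positivity)]
      nlinarith [sq_nonneg (#S : ℝ)]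
    have b3 : (#S : ℝ) ^ 2 ≤ (n : ℝ) ^ (2 / 3 : ℝ) := by
      have : (#S : ℝ) ^ 3 ≤ n := by exact_mod_cast not_lt.1 hS
      calc (#S : ℝ) ^ 2 = ((#S : ℝ) ^ 3) ^ (2 / 3 : ℝ) := by
            rw [← rpow_natCast, ← rpow_natCast, ← rpow_mul (by positivity)]
            norm_num
        _ ≤ _ := by gcongr
    calc _ ≤ (n : ℝ) ^ (2 / 3 : ℝ) * (2 * log n / n) := by
          gcongr
          exact b1.trans (b2.trans b3)
      _ = 2 * (log n * ((n : ℝ) ^ (2 / 3 : ℝ) / (n : ℝ) ^ (1 : ℝ))) := by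
          rw [rpow_one]
          field_simp
      _ = _ := by
          rw [← rpow_sub hn0]
          norm_num
  -- At most m²n² edges, each costing at most (2 ln n / n)³ in the exponent.
  have hE : (1 + 1 / ((k : ℝ) - 1) ^ 3) ^
      #(edgesInside (SimpleGraph.completeMultipartiteGraph (fun _ : Fin m => Fin n)) univ) ≤
      exp (8 * m ^ 2 * (log n ^ 3 / n)) := by
    refine (one_add_pow_le_exp_mul (by positivity) _).trans ?_
    rw [exp_le_exp, card_edgesInside_univ_completeMultipartite]
    have : 1 / ((k : ℝ) - 1) ^ 3 ≤ (2 * log n / n) ^ 3 := by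
      rw [← one_div_pow]
      gcongr
    calc (m * n : ℝ) * (((m : ℝ) - 1) * n / 2) * (1 / ((k : ℝ) - 1) ^ 3)
        ≤ (m * n : ℝ) * (m * n) * (2 * log n / n) ^ 3 := by
          gcongr
          nlinarith
      _ = _ := by field_simp; ring
  refine (one_le_probDPColorable_mul _ hk (fun S => n < #S ^ 3) _ (by positivity) hsmall).trans ?_
  unfold momentRatioBound
  have hp := probDPColorable_nonneg
    (SimpleGraph.completeMultipartiteGraph (fun _ : Fin m => Fin n)) k
  have hs := sum_large_agreement_le hm hn hk hc0 hc1 hkc hr ord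
  have hs0 : 0 ≤ ∑ S : Finset (Σ _ : Fin m, Fin n) with n < #S ^ 3, (1 - 1 / (k : ℝ))⁻¹ ^
      #(edgesInside (SimpleGraph.completeMultipartiteGraph (fun _ : Fin m => Fin n)) S) /
        (k : ℝ) ^ #S := sum_nonneg fun S _ => by rw [hq]; positivity
  gcongr

theorem tendsto_log_pow_mul_rpow_neg (j : ℕ) {b : ℝ} (hb : b < 0) :
    Tendsto (fun n : ℕ => log n ^ j * (n : ℝ) ^ b) atTop (𝓝 0) := by
  have h := (isLittleO_log_rpow_rpow_atTop (j : ℝ) (neg_pos.2 hb)).tendsto_div_nhds_zero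
  refine (h.comp tendsto_natCast_atTop_atTop).congr fun n => ?_
  simp only [Function.comp_apply, rpow_natCast]
  rw [rpow_neg (Nat.cast_nonneg n), div_inv_eq_mul]

theorem tendsto_tailRatio (m : ℕ) {c : ℝ} (hc : c < 1) :
    Tendsto (fun n => tailRatio m n c) atTop (𝓝 0) := by
  have h1 := tendsto_log_pow_mul_rpow_neg 1 (b := -(1 / 12)) (by norm_num)
  have h2 := tendsto_log_pow_mul_rpow_neg 1 (b := c - 1) (by linarith)
  simp only [pow_one] at h1 h2
  simpa [tailRatio] using (h1.const_mul (2 * exp 1 * m)).add (h2.const_mul (8 * exp 1))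

theorem tendsto_momentRatioBound (m : ℕ) {c : ℝ} (hc : c < 1) :
    Tendsto (fun n => momentRatioBound m n c) atTop (𝓝 1) := by
  have h1 := tendsto_log_pow_mul_rpow_neg 1 (b := -(1 / 3)) (by norm_num)
  have h2 := tendsto_log_pow_mul_rpow_neg 3 (b := -1) (by norm_num)
  simp only [pow_one, rpow_neg_one, ← div_eq_mul_inv] at h1 h2
  have h3 := (continuous_exp.tendsto _).comp (h2.const_mul (8 * (m : ℝ) ^ 2))
  have h4 := (continuous_exp.tendsto _).comp (h1.const_mul 2)
  simpa [momentRatioBound] using h3.mul (h4.add ((tendsto_tailRatio m hc).const_mul 2))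

end Estimates

/-! ### Both sides of the threshold -/

section SharpThreshold

open Finset Real

/-- The hypothesis `hmn` gives t(n) ≤ n, hence ln k ≤ ln n; the edges contribute at most
exp(-mn(1+ε) ln n), which beats the factor k^(mn). -/
theorem probDPColorable_le_exp_neg {m n k : ℕ} (hm : 2 ≤ m) (hn : 2 ≤ n) {ε : ℝ} (hε : 0 < ε)
    (hmn : ((m : ℝ) - 1) / 2 ≤ log n)
    (hk : (k : ℝ) ≤ (1 - ε) * (((m : ℝ) - 1) * n / (2 * log n)))
    (ord : LinearOrder (Σ _ : Fin m, Fin n)) :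
    probDPColorable (SimpleGraph.completeMultipartiteGraph (fun _ : Fin m => Fin n)) k ≤
      exp (-(ε * log n)) := by
  have hm2 : (2 : ℝ) ≤ m := by exact_mod_cast hm
  have hn2 : (2 : ℝ) ≤ n := by exact_mod_cast hn
  have hL : 0 < log n := log_pos (by linarith)
  have hN : Fintype.card (Σ _ : Fin m, Fin n) = m * n := by simp
  refine (probDPColorable_le_first_moment _ k).trans ?_
  rw [hN]
  -- For k = 0 the convention 1/0 = 0 makes q = 1, but k^(mn) vanishes.
  rcases Nat.eq_zero_or_pos k with rfl | hk0
  · have : m * n ≠ 0 := by positivity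
    rw [Nat.cast_zero, zero_pow this, zero_mul]
    positivity
  have hk1 : (1 : ℝ) ≤ k := by exact_mod_cast hk0
  have hk0' : (0 : ℝ) < k := by linarith
  have hm1 : 0 < (m : ℝ) - 1 := by linarith
  have hA : 0 < ((m : ℝ) - 1) * n / (2 * log n) := by positivity
  -- No upper bound on ε is assumed: k ≥ 1 already rules out ε ≥ 1.
  have hε1 : 0 < 1 - ε := pos_of_mul_pos_left (hk0'.trans_le hk) hA.le
  have h1 : log k ≤ log n := by
    refine log_le_log hk0' ?_
    calc (k : ℝ) ≤ 1 * (((m : ℝ) - 1) * n / (2 * log n)) := by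
          refine hk.trans ?_
          gcongr
          linarith
      _ ≤ n := by
          rw [one_mul, div_le_iff₀ (by positivity)]
          nlinarith
  -- The slack 1 - ε in k becomes a gain 1 + ε because (1+ε)(1-ε) ≤ 1.
  have h2 : (1 + ε) * log n * k ≤ ((m : ℝ) - 1) * n / 2 := by
    calc (1 + ε) * log n * k ≤ (1 + ε) * log n * ((1 - ε) * (((m : ℝ) - 1) * n / (2 * log n))) := by
          gcongr
      _ = (1 - ε ^ 2) * (((m : ℝ) - 1) * n / 2) := by
          field_simp
          ring
      _ ≤ 1 * (((m : ℝ) - 1) * n / 2) := by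
          gcongr
          nlinarith
      _ = _ := one_mul _
  have h3 : (1 + ε) * log n ≤ ((m : ℝ) - 1) * n / 2 / k := by rwa [le_div_iff₀ hk0']
  have hq : 0 ≤ 1 - 1 / (k : ℝ) := by
    rw [sub_nonneg, div_le_one hk0']
    exact hk1
  have h4 : (1 - 1 / (k : ℝ)) ^
      #(edgesInside (SimpleGraph.completeMultipartiteGraph (fun _ : Fin m => Fin n)) univ) ≤
      exp (-((m * n : ℝ) * ((1 + ε) * log n))) := by
    calc _ ≤ exp (-(1 / (k : ℝ))) ^
          #(edgesInside (SimpleGraph.completeMultipartiteGraph (fun _ : Fin m => Fin n)) univ) := by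
          gcongr
          exact one_sub_le_exp_neg _
      _ = exp (-((m * n : ℝ) * (((m : ℝ) - 1) * n / 2 / k))) := by
          rw [← exp_nat_mul, card_edgesInside_univ_completeMultipartite]
          congr 1
          ring
      _ ≤ _ := by gcongr
  have h5 : (k : ℝ) ^ (m * n) ≤ exp ((m * n : ℝ) * log n) := by
    calc (k : ℝ) ^ (m * n) = exp ((m * n : ℝ) * log k) := by
          rw [← Nat.cast_mul, exp_nat_mul, exp_log hk0']
      _ ≤ _ := by gcongr
  calc _ ≤ exp ((m * n : ℝ) * log n) * exp (-((m * n : ℝ) * ((1 + ε) * log n))) := by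
        gcongr
    _ = exp (-((m * n : ℝ) * (ε * log n))) := by
        rw [← exp_add]
        congr 1
        ring
    _ ≤ _ := by
        rw [exp_le_exp, neg_le_neg_iff]
        refine le_mul_of_one_le_left (by positivity) ?_
        nlinarith

theorem nonDPColorableWhp_completeMultipartite {m : ℕ} (hm : 2 ≤ m)
    (ord : ∀ n : ℕ, LinearOrder (Σ _ : Fin m, Fin n)) {ε : ℝ} (hε : 0 < ε) {κ : ℕ → ℕ}
    (hκ : ∀ᶠ n : ℕ in atTop, (κ n : ℝ) ≤ (1 - ε) * (((m : ℝ) - 1) * n / (2 * log n))) :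
    NonDPColorableWhp
      (fun n : ℕ => SimpleGraph.completeMultipartiteGraph (fun _ : Fin m => Fin n)) κ := by
  have hlog : Tendsto (fun n : ℕ => log n) atTop atTop :=
    tendsto_log_atTop.comp tendsto_natCast_atTop_atTop
  have hlim : Tendsto (fun n : ℕ => exp (-(ε * log n))) atTop (𝓝 0) :=
    tendsto_exp_neg_atTop_nhds_zero.comp (hlog.const_mul_atTop hε)
  refine squeeze_zero' (Eventually.of_forall fun n => probDPColorable_nonneg _ _) ?_ hlim
  filter_upwards [hκ, eventually_ge_atTop 2, hlog.eventually_ge_atTop (((m : ℝ) - 1) / 2)]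
    with n h1 h2 h3
  exact probDPColorable_le_exp_neg hm h2 hε h3 h1 (ord n)

theorem dpColorableWhp_completeMultipartite {m : ℕ} (hm : 2 ≤ m)
    (ord : ∀ n : ℕ, LinearOrder (Σ _ : Fin m, Fin n)) {ε : ℝ} (hε : 0 < ε) {κ : ℕ → ℕ}
    (hκ : ∀ᶠ n : ℕ in atTop, (1 + ε) * (((m : ℝ) - 1) * n / (2 * log n)) ≤ (κ n : ℝ)) :
    DPColorableWhp
      (fun n : ℕ => SimpleGraph.completeMultipartiteGraph (fun _ : Fin m => Fin n)) κ := by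
  have hm2 : (2 : ℝ) ≤ m := by exact_mod_cast hm
  have hm1 : 0 < (m : ℝ) - 1 := by linarith
  -- Half of ε makes c < 1; the other half absorbs the passage from k to k - 1, since ln n = o(n).
  set c : ℝ := 1 / (1 + ε / 2) with hc
  have hc0 : 0 < c := by positivity
  have hc1 : c < 1 := by
    rw [hc, div_lt_one (by positivity)]
    linarith
  have hlim := (tendsto_momentRatioBound m hc1).inv₀ one_ne_zero
  rw [inv_one] at hlim
  have hlogn : Tendsto (fun n : ℕ => log n * (n : ℝ) ^ (-1 : ℝ)) atTop (𝓝 0) := by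
    simpa only [pow_one] using tendsto_log_pow_mul_rpow_neg 1 (b := -1) (by norm_num)
  refine tendsto_of_tendsto_of_tendsto_of_le_of_le' hlim tendsto_const_nhds ?_
    (Eventually.of_forall fun n => probDPColorable_le_one _ _)
  filter_upwards [hκ, eventually_ge_atTop 2, hlogn.eventually_le_const (by positivity : 0 < ε / 4),
    (tendsto_tailRatio m hc1).eventually_le_const (by norm_num : (0 : ℝ) < 1 / 2)]
    with n hk hn hsmall hr
  have hn2 : (2 : ℝ) ≤ n := by exact_mod_cast hn
  have hn0 : (0 : ℝ) < n := by linarith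
  have hL : 0 < log n := log_pos (by linarith)
  rw [rpow_neg_one, ← div_eq_mul_inv, div_le_iff₀ hn0] at hsmall
  have h1 : (1 + ε) * (((m : ℝ) - 1) * n / 2) ≤ κ n * log n := by
    calc _ = (1 + ε) * (((m : ℝ) - 1) * n / (2 * log n)) * log n := by field_simp
      _ ≤ _ := by gcongr
  have h2 : log n ≤ ε / 2 * (((m : ℝ) - 1) * n / 2) := by
    have : (n : ℝ) ≤ ((m : ℝ) - 1) * n := by nlinarith
    nlinarith
  have h3 : (1 + ε / 2) * (((m : ℝ) - 1) * n / 2) ≤ log n * ((κ n : ℝ) - 1) := by linarith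
  have h4 : ((m : ℝ) - 1) * n / 2 ≤ c * log n * ((κ n : ℝ) - 1) := by
    rw [hc, mul_assoc, one_div_mul_eq_div, le_div_iff₀ (by positivity)]
    linarith
  have h5 : 0 < (κ n : ℝ) - 1 := by
    refine pos_of_mul_pos_right (lt_of_lt_of_le ?_ h3) hL.le
    positivity
  have h6 : 2 ≤ κ n := by
    have : (1 : ℝ) < κ n := by linarith
    exact_mod_cast this
  have h7 := one_le_probDPColorable_mul_momentRatioBound hm (by omega) h6 hc0 hc1.le h4 hr (ord n)
  have h8 : 0 < momentRatioBound m n c :=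
    pos_of_mul_pos_right (one_pos.trans_le h7) (probDPColorable_nonneg _ _)
  rwa [inv_le_iff_one_le_mul₀ h8]

end SharpThreshold

-- `ord n` is an arbitrary enumeration of the vertices of the complete multipartite graph, which
-- the random cover uses to orient the edges.
theorem corollary1p5 (m : ℕ) (hm : 2 ≤ m)
    (ord : ∀ n : ℕ, LinearOrder (Σ _ : Fin m, Fin n)) :
    IsSharpDPThreshold
      (fun n : ℕ => SimpleGraph.completeMultipartiteGraph (fun _ : Fin m => Fin n))
      (fun n : ℕ => ((m : ℝ) - 1) * (n : ℝ) / (2 * Real.log (n : ℝ))) := by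
  intro ε hε κ
  exact ⟨nonDPColorableWhp_completeMultipartite hm ord hε,
    dpColorableWhp_completeMultipartite hm ord hε⟩
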